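/- Let $K$ be a number field with ring of integers $\mathcal{O}_K$, and let $c \in K^\times$ be a non-square. For a nonzero prime ideal $\mathfrak{p}$ of $\mathcal{O}_K$ let $\mathbf{N}\mathfrak{p} = |\mathcal{O}_K/\mathfrak{p}|$, and let $\left(\frac{c}{\mathfrak{p}}\right)$ be the Legendre symbol: if $\mathfrak{p}\nmid 2$ and $\operatorname{ord}_{\mathfrak{p}}(c)=0$, it is $1$ if the image of $c$ in the residue field at $\mathfrak{p}$ is a square and $-1$ otherwise; at the finitely many remaining primes it is $0$. Then, as the real variable $X$ tends to $\infty$, $$\sum_{\mathbf{N}\mathfrak{p}\le X} \frac{1+\left(\frac{c}{\mathfrak{p}}\right)}{\mathbf{N}\mathfrak{p}} = \log\log X + O(1),$$ where the sum runs over the nonzero prime ideals $\mathfrak{p}$ of $\mathcal{O}_K$ with $\mathbf{N}\mathfrak{p}\le X$, and the implied constant may depend on $K$ and $c$. -/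

import Mathlib

open Filter Asymptotics NumberField IsDedekindDomain

noncomputable section

namespace NumberFieldLegendre

variable {K : Type*} [Field K] [NumberField K]

open scoped Classical in
/-- The Legendre symbol `(c / 𝔭)` of `c ∈ K` at a nonzero prime ideal `𝔭` of `𝓞 K`.
If `𝔭 ∤ 2` and `c` is a unit at `𝔭`, it is `1` or `-1` according to whether or not `c` is congruent
to a square modulo the maximal ideal of the local ring at `𝔭` (that is, its image in the residue
field of `𝔭` is a square). At the other primes (those dividing `2`, or occurring
in the factorization of the fractional ideal `(c)`) it is `0`. -/
def legendreSymbol (c : K) (𝔭 : HeightOneSpectrum (𝓞 K)) : ℤ :=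
  if (2 : 𝓞 K) ∈ 𝔭.asIdeal ∨ 𝔭.valuation K c ≠ 1 then 0
  else if ∃ x : K, 𝔭.valuation K (c - x ^ 2) < 1 then 1
  else -1

variable (K) in
theorem finite_primes_absNorm_le (X : ℝ) :
    {𝔭 : HeightOneSpectrum (𝓞 K) | (Ideal.absNorm 𝔭.asIdeal : ℝ) ≤ X}.Finite := by
  have h := Ideal.finite_setOfPred_absNorm_le (S := 𝓞 K) ⌊X⌋₊
  refine Set.Finite.of_finite_image (f := HeightOneSpectrum.asIdeal) (h.subset ?_) ?_
  · rintro _ ⟨𝔭, h𝔭, rfl⟩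
    exact Nat.le_floor h𝔭
  · intro 𝔭 _ 𝔮 _ e
    exact HeightOneSpectrum.ext e

variable (K) in
/-- The finite set of nonzero prime ideals `𝔭` of `𝓞 K` with norm `N𝔭 ≤ X`. -/
def primesUpTo (X : ℝ) : Finset (HeightOneSpectrum (𝓞 K)) :=
  (finite_primes_absNorm_le K X).toFinset

end NumberFieldLegendre

end

/-!
The sum in question is, up to `O(1)`, the sum of `1 / N𝔓` over the prime ideals `𝔓` of the quadratic
extension `L = K(√c)`, so the theorem is Mertens' estimate `∑_{N𝔓 ≤ X} 1 / N𝔓 = log log X + O(1)`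
for `L`.

*Reduction to `L`.* Outside a finite set of primes `𝔭` of `K`, if `c` is a square modulo `𝔭`, then
there are two primes of `L` over `𝔭`, both of norm `N𝔭` (`exists_ne_under_eq`); otherwise every
prime over `𝔭` has degree two (`exists_sub_sq_mem_under`). Hence the primes of degree one over `𝔭`
number `1 + (c / 𝔭)`, while the primes of degree two contribute at most `2 ∑ 1 / N𝔭² < ∞`. This is
`exists_abs_sum_sub_sum_le`.

*Mertens' estimate for a number field.* The simple pole of the Dedekind zeta function at `1` and the
Euler product give `∑ N𝔓⁻ˢ = log (1 / (s - 1)) + O(1)` as `s → 1⁺`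
(`exists_eventually_abs_tsum_primes_sub_log_le`). At `s = 1 + 1 / log X` the main term is
`log log X`, and what remains is to show that this sum differs from `∑_{N𝔓 ≤ X} 1 / N𝔓` by `O(1)`.
That only needs Chebyshev's upper bound `#{𝔓 : N𝔓 ≤ X} = O(X / log X)`, which follows from the
bound over `ℚ` (`card_primesUpTo_le`). The comparison is `sum_inv_sub_log_log_isBigO`; it splits
the primes into shells `k ≤ log N𝔓 < k + 1`, each of which carries mass `O(1 / (k + 1))`.
-/

namespace NumberFieldLegendre

/-! ### A Tauberian argument -/

section Tauberian

variable {ι : Type*} {N : ι → ℝ} {U : ℝ → Finset ι} {C : ℝ}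

/-- The shell `k ≤ log N < k + 1` carries mass `O(1 / (k + 1))`: it has `O(eᵏ / (k + 1))` members,
each contributing at most `e⁻ᵏ`. -/
theorem sum_inv_shell_le (hN : ∀ i, 1 ≤ N i) (hU : ∀ X i, i ∈ U X ↔ N i ≤ X)
    (hC : ∀ x : ℝ, 2 ≤ x → ((U x).card : ℝ) ≤ C * x / Real.log x) (F : Finset ι) (k : ℕ) :
    ∑ i ∈ F with ⌊Real.log (N i)⌋₊ = k, (N i)⁻¹ ≤ C * Real.exp 1 / (k + 1) := by
  have hcard : ((F.filter fun i => ⌊Real.log (N i)⌋₊ = k).card : ℝ)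
      ≤ C * Real.exp (k + 1) / (k + 1) := by
    have h2 : (2 : ℝ) ≤ Real.exp (k + 1) := by
      have := Real.add_one_le_exp ((k : ℝ) + 1)
      have : (0 : ℝ) ≤ k := k.cast_nonneg
      linarith
    have h := hC _ h2
    rw [Real.log_exp] at h
    refine le_trans ?_ h
    exact_mod_cast Finset.card_le_card fun i hi => by
      rw [Finset.mem_filter] at hi
      rw [hU, ← Real.log_le_iff_le_exp (by linarith [hN i]), ← hi.2]
      exact_mod_cast (Nat.lt_floor_add_one (Real.log (N i))).le
  calc ∑ i ∈ F with ⌊Real.log (N i)⌋₊ = k, (N i)⁻¹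
      ≤ ∑ i ∈ F with ⌊Real.log (N i)⌋₊ = k, Real.exp (-k) := by
        refine Finset.sum_le_sum fun i hi => ?_
        rw [Finset.mem_filter] at hi
        have h0 : 0 < N i := by linarith [hN i]
        rw [Real.exp_neg]
        refine inv_anti₀ (Real.exp_pos _) ?_
        rw [← Real.le_log_iff_exp_le h0, ← hi.2]
        exact Nat.floor_le (Real.log_nonneg (hN i))
    _ = (F.filter fun i => ⌊Real.log (N i)⌋₊ = k).card * Real.exp (-k) := by
        rw [Finset.sum_const, nsmul_eq_mul]
    _ ≤ C * Real.exp (k + 1) / (k + 1) * Real.exp (-k) := by gcongr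
    _ = C * Real.exp 1 / (k + 1) := by
        rw [Real.exp_add, Real.exp_neg]
        field_simp

theorem sum_log_div_le (hN : ∀ i, 1 ≤ N i) (hU : ∀ X i, i ∈ U X ↔ N i ≤ X)
    (hC : ∀ x : ℝ, 2 ≤ x → ((U x).card : ℝ) ≤ C * x / Real.log x) {X : ℝ} (hX : 1 ≤ X) :
    ∑ i ∈ U X, Real.log (N i) * (N i)⁻¹ ≤ C * Real.exp 1 * (Real.log X + 1) := by
  have hC0 : 0 ≤ C * Real.exp 1 := by
    simpa using (Finset.sum_nonneg fun i _ => inv_nonneg.2 (by linarith [hN i])).trans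
      (sum_inv_shell_le hN hU hC ∅ 0)
  have hmaps : ∀ i ∈ U X, ⌊Real.log (N i)⌋₊ ∈ Finset.range (⌊Real.log X⌋₊ + 1) := fun i hi => by
    rw [Finset.mem_range, Nat.lt_succ_iff]
    exact Nat.floor_mono (Real.log_le_log (by linarith [hN i]) ((hU X i).1 hi))
  rw [← Finset.sum_fiberwise_of_maps_to hmaps]
  calc _ ≤ ∑ k ∈ Finset.range (⌊Real.log X⌋₊ + 1), C * Real.exp 1 := by
        refine Finset.sum_le_sum fun k _ => ?_
        calc _ ≤ ∑ i ∈ U X with ⌊Real.log (N i)⌋₊ = k, (k + 1 : ℝ) * (N i)⁻¹ := by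
              refine Finset.sum_le_sum fun i hi => ?_
              rw [Finset.mem_filter] at hi
              have h0 : 0 < N i := by linarith [hN i]
              rw [← hi.2]
              gcongr
              exact (Nat.lt_floor_add_one (Real.log (N i))).le
          _ ≤ (k + 1 : ℝ) * (C * Real.exp 1 / (k + 1)) := by
              rw [← Finset.mul_sum]
              gcongr
              exact sum_inv_shell_le hN hU hC _ k
          _ = C * Real.exp 1 := by field_simp
    _ = C * Real.exp 1 * (⌊Real.log X⌋₊ + 1) := by
        rw [Finset.sum_const, nsmul_eq_mul, Finset.card_range]
        push_cast
        ring
    _ ≤ _ := by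
        gcongr
        exact Nat.floor_le (Real.log_nonneg hX)

/-- At `s = 1 + 1 / log X` the tail `N ≥ X` of the zeta sum is bounded: the shell bound turns it into
a geometric series of ratio `exp (-1 / log X)`. -/
theorem sum_rpow_tail_le (hN : ∀ i, 1 ≤ N i) (hU : ∀ X i, i ∈ U X ↔ N i ≤ X)
    (hC : ∀ x : ℝ, 2 ≤ x → ((U x).card : ℝ) ≤ C * x / Real.log x) {X : ℝ}
    (hX : Real.exp 1 ≤ X) (F : Finset ι) (hF : ∀ i ∈ F, X ≤ N i) :
    ∑ i ∈ F, N i ^ (-(1 + (Real.log X)⁻¹)) ≤ 2 * (C * Real.exp 1) := by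
  have hC0 : 0 ≤ C * Real.exp 1 := by
    simpa using (Finset.sum_nonneg fun i _ => inv_nonneg.2 (by linarith [hN i])).trans
      (sum_inv_shell_le hN hU hC ∅ 0)
  have hX0 : 0 < X := (Real.exp_pos _).trans_le hX
  have hlog : 1 ≤ Real.log X := (Real.le_log_iff_exp_le hX0).2 hX
  set ε := (Real.log X)⁻¹ with hε
  have hε0 : 0 < ε := by positivity
  have hε1 : ε ≤ 1 := inv_le_one_of_one_le₀ hlog
  have hr : Real.exp (-ε) < 1 := by simpa using hε0
  have hshell : ∀ k ∈ F.image fun i => ⌊Real.log (N i)⌋₊,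
      ∑ i ∈ F with ⌊Real.log (N i)⌋₊ = k, N i ^ (-(1 + ε))
        ≤ C * Real.exp 1 * ε * Real.exp (-ε) ^ k := fun k hk => by
    obtain ⟨j, hj, hjk⟩ := Finset.mem_image.1 hk
    have hkX : Real.log X ≤ k + 1 := by
      rw [← hjk]
      exact (Real.log_le_log hX0 (hF j hj)).trans (Nat.lt_floor_add_one _).le
    calc _ ≤ ∑ i ∈ F with ⌊Real.log (N i)⌋₊ = k, Real.exp (-ε) ^ k * (N i)⁻¹ := by
          refine Finset.sum_le_sum fun i hi => ?_
          rw [Finset.mem_filter] at hi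
          have h0 : 0 < N i := by linarith [hN i]
          rw [neg_add, Real.rpow_add h0, Real.rpow_neg_one, mul_comm]
          gcongr
          rw [Real.rpow_def_of_pos h0, ← Real.exp_nat_mul, Real.exp_le_exp, ← hi.2]
          have := Nat.floor_le (Real.log_nonneg (hN i))
          nlinarith
      _ ≤ Real.exp (-ε) ^ k * (C * Real.exp 1 / (k + 1)) := by
          rw [← Finset.mul_sum]
          gcongr
          exact sum_inv_shell_le hN hU hC _ k
      _ ≤ Real.exp (-ε) ^ k * (C * Real.exp 1 / Real.log X) := by gcongr
      _ = _ := by rw [hε]; ring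
  rw [← Finset.sum_fiberwise_of_maps_to fun i hi =>
    Finset.mem_image_of_mem (fun i => ⌊Real.log (N i)⌋₊) hi]
  calc _ ≤ ∑ k ∈ F.image fun i => ⌊Real.log (N i)⌋₊, C * Real.exp 1 * ε * Real.exp (-ε) ^ k :=
        Finset.sum_le_sum hshell
    _ ≤ C * Real.exp 1 * ε * (1 - Real.exp (-ε))⁻¹ := by
        rw [← Finset.mul_sum]
        gcongr
        rw [← tsum_geometric_of_lt_one (Real.exp_pos _).le hr]
        exact (summable_geometric_of_lt_one (Real.exp_pos _).le hr).sum_le_tsum _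
          fun _ _ => by positivity
    _ ≤ 2 * (C * Real.exp 1) := by
        -- `1 - exp (-ε) ≥ ε / (1 + ε) ≥ ε / 2`
        have h1 : ε / 2 ≤ 1 - Real.exp (-ε) := by
          have h2 : Real.exp (-ε) ≤ (1 + ε)⁻¹ := by
            rw [Real.exp_neg]
            exact inv_anti₀ (by positivity) (by linarith [Real.add_one_le_exp ε])
          have h3 : (1 + ε)⁻¹ ≤ 1 - ε / 2 := by
            rw [inv_le_iff_one_le_mul₀ (by positivity)]
            nlinarith
          linarith
        have h4 : ε * (1 - Real.exp (-ε))⁻¹ ≤ 2 := by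
          rw [← div_eq_mul_inv, div_le_iff₀ (by linarith)]
          linarith
        nlinarith

/-- If a family of norms obeys a Chebyshev bound, and its zeta sum at `s` is
`log (1 / (s - 1)) + O(1)` as `s → 1⁺`, then Mertens' estimate holds for it. -/
theorem sum_inv_sub_log_log_isBigO (hN : ∀ i, 1 ≤ N i) (hU : ∀ X i, i ∈ U X ↔ N i ≤ X)
    (hC : ∀ x : ℝ, 2 ≤ x → ((U x).card : ℝ) ≤ C * x / Real.log x) {D : ℝ}
    (hD : ∀ᶠ s : ℝ in nhdsWithin 1 (Set.Ioi 1), Summable (fun i => N i ^ (-s)) ∧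
      |∑' i, N i ^ (-s) - Real.log (s - 1)⁻¹| ≤ D) :
    (fun X : ℝ => ∑ i ∈ U X, (N i)⁻¹ - Real.log (Real.log X)) =O[atTop] (fun _ => (1 : ℝ)) := by
  have hC0 : 0 ≤ C * Real.exp 1 := by
    simpa using (Finset.sum_nonneg fun i _ => inv_nonneg.2 (by linarith [hN i])).trans
      (sum_inv_shell_le hN hU hC ∅ 0)
  have hlim : Tendsto (fun X : ℝ => 1 + (Real.log X)⁻¹) atTop (nhdsWithin 1 (Set.Ioi 1)) := by
    refine tendsto_nhdsWithin_iff.2 ⟨?_, ?_⟩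
    · simpa using (tendsto_inv_atTop_zero.comp Real.tendsto_log_atTop).const_add 1
    · filter_upwards [eventually_gt_atTop 1] with X hX
      have := Real.log_pos hX
      simpa using this
  refine IsBigO.of_bound (2 * (C * Real.exp 1) + D) ?_
  filter_upwards [hlim.eventually hD, eventually_ge_atTop (Real.exp 1)] with X ⟨hsum, hX⟩ heX
  have hX0 : 0 < X := (Real.exp_pos _).trans_le heX
  have hlog : 1 ≤ Real.log X := (Real.le_log_iff_exp_le hX0).2 heX
  have hX1 : 1 ≤ X := by linarith [Real.add_one_le_exp (1 : ℝ)]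
  rw [add_sub_cancel_left, inv_inv] at hX
  set s := 1 + (Real.log X)⁻¹ with hs
  -- truncating at `N ≤ X` and replacing `s` by `1` both cost `O(1)`
  have hhead0 : ∀ i, N i ^ (-s) ≤ (N i)⁻¹ := fun i => by
    rw [← Real.rpow_neg_one]
    exact Real.rpow_le_rpow_of_exponent_le (hN i) (by rw [hs]; simp; linarith)
  have hhead : ∑ i ∈ U X, (N i)⁻¹ - ∑ i ∈ U X, N i ^ (-s) ≤ 2 * (C * Real.exp 1) := by
    rw [← Finset.sum_sub_distrib]
    calc _ ≤ ∑ i ∈ U X, (Real.log X)⁻¹ * (Real.log (N i) * (N i)⁻¹) := by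
          refine Finset.sum_le_sum fun i _ => ?_
          have h0 : 0 < N i := by linarith [hN i]
          have h1 : 1 - (Real.log X)⁻¹ * Real.log (N i) ≤ N i ^ (-(Real.log X)⁻¹) := by
            rw [Real.rpow_def_of_pos h0]
            linarith [Real.add_one_le_exp (Real.log (N i) * -(Real.log X)⁻¹)]
          have h2 : 0 < (N i)⁻¹ := by positivity
          rw [hs, neg_add, Real.rpow_add h0, Real.rpow_neg_one]
          nlinarith
      _ ≤ (Real.log X)⁻¹ * (C * Real.exp 1 * (Real.log X + 1)) := by
          rw [← Finset.mul_sum]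
          gcongr
          exact sum_log_div_le hN hU hC hX1
      _ ≤ (Real.log X)⁻¹ * (C * Real.exp 1 * (Real.log X + Real.log X)) := by gcongr
      _ = _ := by field_simp; ring
  have hhead' : ∑ i ∈ U X, N i ^ (-s) ≤ ∑ i ∈ U X, (N i)⁻¹ :=
    Finset.sum_le_sum fun i _ => hhead0 i
  have htail0 : ∑ i ∈ U X, N i ^ (-s) ≤ ∑' i, N i ^ (-s) :=
    hsum.sum_le_tsum _ fun i _ => Real.rpow_nonneg (by linarith [hN i]) _
  have htail : ∑' i, N i ^ (-s) ≤ ∑ i ∈ U X, N i ^ (-s) + 2 * (C * Real.exp 1) := by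
    classical
    refine hsum.tsum_le_of_sum_le fun F => ?_
    rw [← Finset.sum_filter_add_sum_filter_not F (· ∈ U X)]
    refine add_le_add (Finset.sum_le_sum_of_subset_of_nonneg ?_ ?_)
      (sum_rpow_tail_le hN hU hC heX _ ?_)
    · exact fun i hi => (Finset.mem_filter.1 hi).2
    · exact fun i _ _ => Real.rpow_nonneg (by linarith [hN i]) _
    · exact fun i hi => (not_le.1 ((hU X i).not.1 (Finset.mem_filter.1 hi).2)).le
  rw [norm_one, mul_one, Real.norm_eq_abs]
  rw [abs_le] at hX ⊢
  constructor <;> linarith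

end Tauberian

/-! ### Counting prime ideals -/

section PrimesOver

variable {A B : Type*} [CommRing A] [IsDedekindDomain A] [CommRing B] [IsDedekindDomain B]
  [Algebra A B] [Module.Finite A B] [Module.IsTorsionFree A B]

/-- The inequality `∑ f ≤ [L : K]` for some of the primes over `p`, from `∑ e f = [L : K]`. -/
theorem sum_inertiaDeg_le_finrank (p : HeightOneSpectrum A) (F : Finset (HeightOneSpectrum B))
    (hF : ∀ P ∈ F, P.under A = p) :
    ∑ P ∈ F, P.asIdeal.inertiaDeg A ≤ Module.finrank A B := by
  classical
  have := p.isMaximal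
  have := p.isPrime
  have hover : ∀ P ∈ F, P.asIdeal ∈ p.asIdeal.primesOver B := fun P hP =>
    ⟨P.isPrime, ⟨by rw [← hF P hP]; rfl⟩⟩
  rw [← Ideal.sum_ramification_inertia_eq_finrank p.asIdeal B, ← F.sum_attach]
  have hg : Set.InjOn (fun P : F => (⟨P.1.asIdeal, hover _ P.2⟩ : p.asIdeal.primesOver B))
      F.attach := fun P _ Q _ h =>
    Subtype.ext (HeightOneSpectrum.ext (congrArg Subtype.val h))
  refine le_trans ?_ (Finset.sum_le_sum_of_subset
    (Finset.subset_univ (F.attach.image fun P => ⟨P.1.asIdeal, hover _ P.2⟩)))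
  rw [Finset.sum_image hg]
  refine Finset.sum_le_sum fun P _ => Nat.le_mul_of_pos_left _ ?_
  have := P.1.isPrime
  exact Ideal.ramificationIdx_pos _ _

theorem card_le_finrank (p : HeightOneSpectrum A) (F : Finset (HeightOneSpectrum B))
    (hF : ∀ P ∈ F, P.under A = p) : F.card ≤ Module.finrank A B := by
  refine le_trans ?_ (sum_inertiaDeg_le_finrank p F hF)
  rw [Finset.card_eq_sum_ones]
  refine Finset.sum_le_sum fun P _ => ?_
  have := P.isPrime
  exact Ideal.inertiaDeg_pos _ _

end PrimesOver

section Counting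

variable (K : Type*) [Field K] [NumberField K]

theorem mem_primesUpTo {X : ℝ} {P : HeightOneSpectrum (𝓞 K)} :
    P ∈ primesUpTo K X ↔ (Ideal.absNorm P.asIdeal : ℝ) ≤ X := by
  simp [primesUpTo]

variable {K} in
theorem two_le_absNorm (P : HeightOneSpectrum (𝓞 K)) : 2 ≤ Ideal.absNorm P.asIdeal := by
  have h0 : Ideal.absNorm P.asIdeal ≠ 0 := by
    rw [Ne, Ideal.absNorm_eq_zero_iff]
    exact P.ne_bot
  have h1 : Ideal.absNorm P.asIdeal ≠ 1 := by
    rw [Ne, Ideal.absNorm_eq_one_iff]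
    exact P.isPrime.ne_top
  omega

/-- Chebyshev's upper bound for the number of prime ideals of norm at most `x`: there are at most
`[K : ℚ]` of them over each rational prime, and none has norm less than the prime below it. -/
theorem card_primesUpTo_le {x : ℝ} (hx : 2 ≤ x) :
    ((primesUpTo K x).card : ℝ) ≤
      Module.finrank ℤ (𝓞 K) * (2 * Real.log 4 + 2) * x / Real.log x := by
  have hcard : (primesUpTo K x).card ≤ Module.finrank ℤ (𝓞 K) * (Nat.primesLE ⌊x⌋₊).card := by
    refine Finset.card_le_mul_card_image_of_maps_to
      (f := fun P => Ideal.absNorm (P.asIdeal.under ℤ)) (fun P hP => ?_) _ fun n hn => ?_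
    · have := P.isPrime
      have : NeZero P.asIdeal := ⟨P.ne_bot⟩
      rw [Nat.mem_primesLE]
      refine ⟨Nat.le_floor (le_trans ?_ ((mem_primesUpTo K).1 hP)), Nat.absNorm_under_prime _⟩
      exact_mod_cast Nat.le_of_dvd (by linarith [two_le_absNorm P])
        (Int.absNorm_under_dvd_absNorm P.asIdeal)
    · rcases Finset.eq_empty_or_nonempty
        {P ∈ primesUpTo K x | Ideal.absNorm (P.asIdeal.under ℤ) = n} with h | ⟨Q, hQ⟩
      · simp [h]
      · refine card_le_finrank (Q.under ℤ) _ fun P hP => HeightOneSpectrum.ext ?_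
        rw [Finset.mem_filter] at hP hQ
        change P.asIdeal.under ℤ = Q.asIdeal.under ℤ
        rw [← Int.ideal_span_absNorm_eq_self (P.asIdeal.under ℤ), hP.2, ← hQ.2,
          Int.ideal_span_absNorm_eq_self]
  rw [Nat.primesLE_card_eq_primeCounting] at hcard
  have hlog : 0 < Real.log x := Real.log_pos (by linarith)
  have hsqrt : √x ≤ 2 * x / Real.log x := by
    have h1 : Real.log x ≤ 2 * √x := by
      have h2 := Real.log_le_sub_one_of_pos (Real.sqrt_pos.2 (by linarith : 0 < x))
      rw [Real.log_sqrt (by linarith)] at h2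
      linarith
    rw [le_div_iff₀ hlog]
    nlinarith [Real.sqrt_nonneg x, Real.mul_self_sqrt (by linarith : 0 ≤ x)]
  calc ((primesUpTo K x).card : ℝ)
      ≤ Module.finrank ℤ (𝓞 K) * (Nat.primeCounting ⌊x⌋₊ : ℝ) := by exact_mod_cast hcard
    _ ≤ Module.finrank ℤ (𝓞 K) * (Real.log 4 * x / Real.log √x + 2 * x / Real.log x) := by
        gcongr
        exact (Chebyshev.pi_le_log4_mul_div (by linarith)).trans (by gcongr)
    _ = _ := by
        rw [Real.log_sqrt (by linarith)]
        field_simp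

end Counting

/-! ### The Dedekind zeta function and the zeta sum over primes -/

section Zeta

variable {K : Type*} [Field K] [NumberField K]

/-- The Dedekind zeta function at a real point, as a sum over ideals. -/
theorem hasSum_absNorm_rpow {s : ℝ} (hs : s ≠ 0) (h : dedekindZeta K s ≠ 0) :
    ∃ Z : ℝ, (Z : ℂ) = dedekindZeta K s ∧
      HasSum (fun I : Ideal (𝓞 K) => (Ideal.absNorm I : ℝ) ^ (-s)) Z := by
  -- a divergent series has the junk sum `0`, so a nonzero value forces convergence
  have hsum : Summable fun n : ℕ => LSeries.term
      (fun n ↦ (Nat.card {I : Ideal (𝓞 K) // Ideal.absNorm I = n} : ℂ)) s n :=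
    by_contra fun hn => h (tsum_eq_zero_of_not_summable hn)
  have hterm : ∀ n : ℕ, LSeries.term
      (fun n ↦ (Nat.card {I : Ideal (𝓞 K) // Ideal.absNorm I = n} : ℂ)) s n =
      ((∑' I : {I : Ideal (𝓞 K) // Ideal.absNorm I = n},
        (Ideal.absNorm I.1 : ℝ) ^ (-s) : ℝ) : ℂ) := by
    intro n
    have h1 : ∀ I : {I : Ideal (𝓞 K) // Ideal.absNorm I = n},
        (Ideal.absNorm I.1 : ℝ) ^ (-s) = (n : ℝ) ^ (-s) := fun I => by rw [I.2]
    rw [tsum_congr h1, tsum_const, nsmul_eq_mul]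
    rcases eq_or_ne n 0 with rfl | hn
    · simp [Real.zero_rpow (neg_ne_zero.2 hs)]
    · rw [LSeries.term_of_ne_zero hn, Real.rpow_neg n.cast_nonneg]
      push_cast
      rw [Complex.ofReal_cpow n.cast_nonneg]
      simp [div_eq_mul_inv]
  have hreal := hsum
  simp_rw [hterm] at hreal
  rw [Complex.summable_ofReal] at hreal
  have hsig : Summable (fun x : Σ n, {I : Ideal (𝓞 K) // Ideal.absNorm I = n} =>
      (Ideal.absNorm x.2.1 : ℝ) ^ (-s)) := by
    refine (summable_sigma_of_nonneg fun _ => by positivity).2 ⟨fun n => ?_, hreal⟩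
    have : Finite {I : Ideal (𝓞 K) // Ideal.absNorm I = n} :=
      Ideal.finite_setOfPred_absNorm_eq n
    exact Summable.of_finite
  have hideal : Summable fun I : Ideal (𝓞 K) => (Ideal.absNorm I : ℝ) ^ (-s) :=
    (Equiv.sigmaFiberEquiv (fun I : Ideal (𝓞 K) => Ideal.absNorm I)).summable_iff.1 hsig
  refine ⟨_, ?_, hideal.hasSum⟩
  rw [← (Equiv.sigmaFiberEquiv (fun I : Ideal (𝓞 K) => Ideal.absNorm I)).tsum_eq]
  refine (congrArg _ hsig.tsum_sigma).trans ?_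
  rw [Complex.ofReal_tsum]
  exact (tsum_congr hterm).symm

/-- One half of the Euler product: expanding the product gives distinct squarefree ideals. -/
theorem prod_one_add_absNorm_rpow_le {s Z : ℝ}
    (hZ : HasSum (fun I : Ideal (𝓞 K) => (Ideal.absNorm I : ℝ) ^ (-s)) Z)
    (F : Finset (HeightOneSpectrum (𝓞 K))) :
    ∏ P ∈ F, (1 + (Ideal.absNorm P.asIdeal : ℝ) ^ (-s)) ≤ Z := by
  classical
  have hinj : Function.Injective
      fun t : Finset (HeightOneSpectrum (𝓞 K)) => ∏ P ∈ t, P.asIdeal := by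
    have hmem : ∀ (t : Finset (HeightOneSpectrum (𝓞 K))) P,
        P ∈ t ↔ P.asIdeal ∣ ∏ Q ∈ t, Q.asIdeal := fun t P => by
      rw [P.prime.dvd_finsetProd_iff]
      refine ⟨fun h => ⟨P, h, dvd_rfl⟩, fun ⟨Q, hQ, h⟩ => ?_⟩
      have := Q.isMaximal.eq_of_le P.isPrime.ne_top (Ideal.le_of_dvd h)
      rwa [← HeightOneSpectrum.ext this]
    intro t u h
    ext P
    rw [hmem, hmem]
    exact iff_of_eq (congrArg _ h)
  have hmul : ∀ t : Finset (HeightOneSpectrum (𝓞 K)),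
      ∏ P ∈ t, (Ideal.absNorm P.asIdeal : ℝ) ^ (-s) =
        (Ideal.absNorm (∏ P ∈ t, P.asIdeal) : ℝ) ^ (-s) := fun t => by
    rw [map_prod, Nat.cast_prod, Real.finsetProd_rpow _ _ fun _ _ => Nat.cast_nonneg _]
  rw [Finset.prod_one_add, Finset.sum_congr rfl fun t _ => hmul t,
    ← Finset.sum_image (f := fun I : Ideal (𝓞 K) => (Ideal.absNorm I : ℝ) ^ (-s)) hinj.injOn]
  exact sum_le_hasSum _ (fun _ _ => by positivity) hZ

theorem inv_one_sub_le_exp {x : ℝ} (h1 : x ≤ 1 / 2) :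
    (1 - x)⁻¹ ≤ Real.exp (x + 2 * x ^ 2) := by
  rw [inv_le_iff_one_le_mul₀ (by linarith)]
  nlinarith [Real.add_one_le_exp (x + 2 * x ^ 2), mul_nonneg (sq_nonneg x) (sub_nonneg.2 h1)]

theorem exp_sub_sq_le_one_add {x : ℝ} (h0 : 0 ≤ x) (h1 : x ≤ 1 / 2) :
    Real.exp (x - x ^ 2) ≤ 1 + x := by
  have h := Real.add_one_le_exp (-(x - x ^ 2))
  have h2 : 0 < -(x - x ^ 2) + 1 := by nlinarith
  rw [Real.exp_neg] at h
  have h3 := inv_anti₀ h2 h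
  rw [inv_inv] at h3
  refine h3.trans ?_
  rw [inv_le_iff_one_le_mul₀ h2]
  nlinarith [pow_nonneg h0 3]

/-- If elements are determined by their exponents, their monomials are distinct terms of the expanded
product of truncated geometric series. -/
theorem exists_sum_prod_pow_le_prod_sum_pow {ι M : Type*} (F : Finset ι) (G : Finset M)
    (m : M → ι → ℕ)
    (hinj : ∀ I ∈ G, ∀ J ∈ G, (∀ i ∈ F, m I i = m J i) → I = J) {x : ι → ℝ} (hx : ∀ i, 0 ≤ x i) :
    ∃ n, ∑ I ∈ G, ∏ i ∈ F, x i ^ m I i ≤ ∏ i ∈ F, ∑ k ∈ Finset.range n, x i ^ k := by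
  classical
  obtain ⟨n, hm⟩ : ∃ n, ∀ i ∈ F, ∀ I ∈ G, m I i < n :=
    ⟨(F.sup fun i => G.sup fun I => m I i) + 1, fun i hi I hI => Nat.lt_succ_iff.2
      ((Finset.le_sup (f := fun I => m I i) hI).trans
        (Finset.le_sup (f := fun i => G.sup fun I => m I i) hi))⟩
  refine ⟨n, ?_⟩
  rw [Finset.prod_sum]
  have hg : Set.InjOn (fun I i (_ : i ∈ F) => m I i) (G : Set M) := fun I hI J hJ h =>
    hinj I hI J hJ fun i hi => congrFun (congrFun h i) hi
  have hsub : G.image (fun I i (_ : i ∈ F) => m I i) ⊆ F.pi fun _ => Finset.range n :=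
      fun e he => by
    obtain ⟨I, hI, rfl⟩ := Finset.mem_image.1 he
    exact Finset.mem_pi.2 fun i hi => Finset.mem_range.2 (hm i hi I hI)
  refine le_trans ?_ (Finset.sum_le_sum_of_subset_of_nonneg hsub fun _ _ _ =>
    Finset.prod_nonneg fun i _ => pow_nonneg (hx i) _)
  rw [Finset.sum_image hg]
  refine (Finset.sum_congr rfl fun I _ => ?_).le
  exact (F.prod_attach fun i => x i ^ m I i).symm

/-- The other half of the Euler product: by unique factorization, every term of a finite sum over
nonzero ideals occurs in the expansion of a finite product of truncated geometric series. -/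
theorem exists_sum_absNorm_rpow_le_prod {s : ℝ} (G : Finset (Ideal (𝓞 K)))
    (hG : ∀ I ∈ G, I ≠ ⊥) :
    ∃ (F : Finset (HeightOneSpectrum (𝓞 K))) (n : ℕ), ∑ I ∈ G, (Ideal.absNorm I : ℝ) ^ (-s) ≤
      ∏ P ∈ F, ∑ k ∈ Finset.range n, ((Ideal.absNorm P.asIdeal : ℝ) ^ (-s)) ^ k := by
  classical
  obtain ⟨F, hprod⟩ : ∃ F : Finset (HeightOneSpectrum (𝓞 K)), ∀ I ∈ G,
      ∏ P ∈ F, P.asIdeal ^ multiplicity P.asIdeal I = I := by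
    have hfin : ∀ I ∈ G, (Function.mulSupport fun P : HeightOneSpectrum (𝓞 K) =>
        P.asIdeal ^ multiplicity P.asIdeal I).Finite := fun I hI => by
      have h := Ideal.hasFiniteMulSupport (hG I hI)
      simp only [HeightOneSpectrum.maxPowDividing_eq_pow_multiplicity (hG I hI)] at h
      exact h
    refine ⟨G.attach.biUnion fun I => (hfin I.1 I.2).toFinset, fun I hI => ?_⟩
    rw [← finprod_eq_finsetProd_of_mulSupport_subset,
      Ideal.finprod_heightOneSpectrum_pow_multiplicity (hG I hI)]
    intro P hP
    exact Finset.mem_biUnion.2 ⟨⟨I, hI⟩, Finset.mem_attach _ _, (hfin I hI).mem_toFinset.2 hP⟩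
  have hinj : ∀ I ∈ G, ∀ J ∈ G,
      (∀ P ∈ F, multiplicity P.asIdeal I = multiplicity P.asIdeal J) → I = J := by
    intro I hI J hJ h
    rw [← hprod I hI, ← hprod J hJ]
    exact Finset.prod_congr rfl fun P hP => by rw [h P hP]
  obtain ⟨n, hn⟩ := exists_sum_prod_pow_le_prod_sum_pow F G
    (fun I P => multiplicity P.asIdeal I) hinj
    (x := fun P => (Ideal.absNorm P.asIdeal : ℝ) ^ (-s)) fun _ => by positivity
  refine ⟨F, n, le_trans (Finset.sum_congr rfl fun I hI => ?_).le hn⟩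
  conv_lhs => rw [← hprod I hI]
  rw [map_prod, Nat.cast_prod, ← Real.finsetProd_rpow _ _ fun _ _ => Nat.cast_nonneg _]
  refine Finset.prod_congr rfl fun P _ => ?_
  rw [map_pow, Nat.cast_pow, Real.rpow_pow_comm (Nat.cast_nonneg _)]

theorem absNorm_rpow_le_half {s : ℝ} (hs : 1 ≤ s) (P : HeightOneSpectrum (𝓞 K)) :
    (Ideal.absNorm P.asIdeal : ℝ) ^ (-s) ≤ 1 / 2 := by
  have h2 : (2 : ℝ) ≤ Ideal.absNorm P.asIdeal := by exact_mod_cast two_le_absNorm P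
  calc (Ideal.absNorm P.asIdeal : ℝ) ^ (-s) ≤ (Ideal.absNorm P.asIdeal : ℝ) ^ (-1 : ℝ) :=
        Real.rpow_le_rpow_of_exponent_le (by linarith) (by linarith)
    _ ≤ 1 / 2 := by
        rw [Real.rpow_neg_one, one_div]
        exact inv_anti₀ two_pos h2

variable (K) in
/-- The simple pole at `1`, in logarithmic form: `log ζ(s) = log (1 / (s - 1)) + O(1)`. -/
theorem eventually_hasSum_absNorm_rpow :
    ∀ᶠ s : ℝ in nhdsWithin 1 (Set.Ioi 1), ∃ Z : ℝ, 0 < Z ∧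
      |Real.log Z - Real.log (s - 1)⁻¹| ≤ |Real.log (dedekindZeta_residue K)| + 1 ∧
      HasSum (fun I : Ideal (𝓞 K) => (Ideal.absNorm I : ℝ) ^ (-s)) Z := by
  have hκ := dedekindZeta_residue_pos K
  have hlim := tendsto_sub_one_mul_dedekindZeta_nhdsGT K
  have hre : Tendsto (fun s : ℝ => ((s - 1) * dedekindZeta K s).re) (nhdsWithin 1 (Set.Ioi 1))
      (nhds (dedekindZeta_residue K)) := by
    exact (Complex.continuous_re.tendsto _).comp hlim
  have hlog := (Real.continuousAt_log hκ.ne').tendsto.comp hre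
  filter_upwards [hre.eventually (eventually_gt_nhds hκ), self_mem_nhdsWithin,
    (hlog.abs.eventually_le_const (lt_add_one _))] with s h1 hs h2
  have hs : 1 < s := hs
  have hne : dedekindZeta K s ≠ 0 := fun h => by simp [h] at h1
  obtain ⟨Z, hZ, hsum⟩ := hasSum_absNorm_rpow (by linarith) hne
  have hZ' : ((s - 1) * dedekindZeta K s).re = (s - 1) * Z := by
    rw [← hZ, ← Complex.ofReal_one, ← Complex.ofReal_sub, ← Complex.ofReal_mul, Complex.ofReal_re]
  rw [hZ'] at h1
  have hZ0 : 0 < Z := (pos_iff_pos_of_mul_pos h1).1 (by linarith)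
  refine ⟨Z, hZ0, ?_, hsum⟩
  rw [Function.comp_apply, hZ', Real.log_mul (by linarith) hZ0.ne'] at h2
  rwa [Real.log_inv, sub_neg_eq_add, add_comm]

variable (K) in
theorem summable_absNorm_inv_sq :
    Summable fun P : HeightOneSpectrum (𝓞 K) => ((Ideal.absNorm P.asIdeal : ℝ) ^ 2)⁻¹ := by
  obtain ⟨s, ⟨Z, -, -, hZ⟩, hs⟩ := ((eventually_hasSum_absNorm_rpow K).and
    (nhdsWithin_le_nhds (eventually_lt_nhds one_lt_two))).exists
  refine (hZ.summable.comp_injective HeightOneSpectrum.asIdeal_injective).of_nonneg_of_le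
    (fun _ => by positivity) fun P => ?_
  have h2 : (2 : ℝ) ≤ Ideal.absNorm P.asIdeal := by exact_mod_cast two_le_absNorm P
  rw [Function.comp_apply, ← Real.rpow_natCast, ← Real.rpow_neg (by linarith)]
  exact Real.rpow_le_rpow_of_exponent_le (by linarith) (by push_cast; linarith)

variable (K) in
/-- `∑ N𝔭⁻ˢ = log (1 / (s - 1)) + O(1)` as `s → 1⁺`. -/
theorem exists_eventually_abs_tsum_primes_sub_log_le :
    ∃ D : ℝ, ∀ᶠ s : ℝ in nhdsWithin 1 (Set.Ioi 1),
      Summable (fun P : HeightOneSpectrum (𝓞 K) => (Ideal.absNorm P.asIdeal : ℝ) ^ (-s)) ∧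
      |∑' P : HeightOneSpectrum (𝓞 K), (Ideal.absNorm P.asIdeal : ℝ) ^ (-s)
        - Real.log (s - 1)⁻¹| ≤ D := by
  set Q := ∑' P : HeightOneSpectrum (𝓞 K), ((Ideal.absNorm P.asIdeal : ℝ) ^ 2)⁻¹ with hQ
  have hQ0 : 0 ≤ Q := tsum_nonneg fun _ => by positivity
  refine ⟨|Real.log (dedekindZeta_residue K)| + 1 + 2 * Q, ?_⟩
  filter_upwards [eventually_hasSum_absNorm_rpow K, self_mem_nhdsWithin] with s
    ⟨Z, hZ0, hZlog, hZ⟩ hs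
  have hs : 1 < s := hs
  have hsum := hZ.summable.comp_injective
    (HeightOneSpectrum.asIdeal_injective (R := 𝓞 K))
  refine ⟨hsum, ?_⟩
  have hx0 : ∀ P : HeightOneSpectrum (𝓞 K), 0 ≤ (Ideal.absNorm P.asIdeal : ℝ) ^ (-s) :=
    fun _ => by positivity
  have hx1 := absNorm_rpow_le_half (K := K) hs.le
  have hsq : ∀ F : Finset (HeightOneSpectrum (𝓞 K)),
      ∑ P ∈ F, ((Ideal.absNorm P.asIdeal : ℝ) ^ (-s)) ^ 2 ≤ Q := fun F => by
    refine le_trans (Finset.sum_le_sum fun P _ => ?_)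
      ((summable_absNorm_inv_sq K).sum_le_tsum F fun _ _ => by positivity)
    have h2 : (2 : ℝ) ≤ Ideal.absNorm P.asIdeal := by exact_mod_cast two_le_absNorm P
    rw [← inv_pow, ← Real.rpow_neg_one]
    gcongr
    linarith
  have hupper : ∑' P : HeightOneSpectrum (𝓞 K), (Ideal.absNorm P.asIdeal : ℝ) ^ (-s)
      ≤ Real.log Z + Q := by
    refine hsum.tsum_le_of_sum_le fun F => ?_
    have h := (Finset.prod_le_prod (fun _ _ => (Real.exp_pos _).le) fun P _ =>
      exp_sub_sq_le_one_add (hx0 P) (hx1 P)).trans (prod_one_add_absNorm_rpow_le hZ F)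
    rw [← Real.exp_sum, ← Real.le_log_iff_exp_le hZ0, Finset.sum_sub_distrib] at h
    simp only [Function.comp_apply]
    linarith [hsq F]
  have hlower : Real.log Z ≤
      ∑' P : HeightOneSpectrum (𝓞 K), (Ideal.absNorm P.asIdeal : ℝ) ^ (-s) + 2 * Q := by
    rw [Real.log_le_iff_le_exp hZ0]
    refine hasSum_le_of_sum_le hZ fun G => ?_
    classical
    -- the zero ideal contributes `0 ^ (-s) = 0`
    have hbot : ∑ I ∈ G, (Ideal.absNorm I : ℝ) ^ (-s) =
        ∑ I ∈ G with I ≠ ⊥, (Ideal.absNorm I : ℝ) ^ (-s) := by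
      rw [Finset.sum_filter]
      refine Finset.sum_congr rfl fun I _ => ?_
      split_ifs with h
      · rfl
      · rw [not_not.1 h, Ideal.absNorm_bot, Nat.cast_zero, Real.zero_rpow (by linarith)]
    obtain ⟨F, n, hF⟩ := exists_sum_absNorm_rpow_le_prod (s := s) (G.filter (· ≠ ⊥))
      fun I hI => (Finset.mem_filter.1 hI).2
    rw [hbot]
    refine hF.trans ?_
    calc _ ≤ ∏ P ∈ F, Real.exp ((Ideal.absNorm P.asIdeal : ℝ) ^ (-s) +
            2 * ((Ideal.absNorm P.asIdeal : ℝ) ^ (-s)) ^ 2) := by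
          refine Finset.prod_le_prod (fun _ _ => by positivity) fun P _ =>
            le_trans ?_ (inv_one_sub_le_exp (hx1 P))
          have h1 : (Ideal.absNorm P.asIdeal : ℝ) ^ (-s) < 1 := by linarith [hx1 P]
          rw [← tsum_geometric_of_lt_one (hx0 P) h1]
          exact (summable_geometric_of_lt_one (hx0 P) h1).sum_le_tsum _
            fun _ _ => by positivity
      _ ≤ _ := by
          rw [← Real.exp_sum, Real.exp_le_exp, Finset.sum_add_distrib, ← Finset.mul_sum]
          have := hsum.sum_le_tsum F fun P _ => hx0 P
          linarith [hsq F]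
  rw [abs_le] at hZlog ⊢
  constructor <;> linarith

variable (K) in
/-- Mertens' theorem for a number field. -/
theorem sum_primesUpTo_inv_absNorm_isBigO :
    (fun X : ℝ => ∑ P ∈ primesUpTo K X, (Ideal.absNorm P.asIdeal : ℝ)⁻¹
      - Real.log (Real.log X)) =O[atTop] (fun _ => (1 : ℝ)) := by
  obtain ⟨D, hD⟩ := exists_eventually_abs_tsum_primes_sub_log_le K
  exact sum_inv_sub_log_log_isBigO
    (fun P => by exact_mod_cast (one_le_two.trans (two_le_absNorm P)))
    (fun X P => mem_primesUpTo K) (fun x hx => card_primesUpTo_le K hx) hD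

end Zeta

/-! ### Prime ideals in a quadratic extension -/

section Splitting

theorem valuation_le_one_of_sub_sq {F Γ : Type*} [Field F] [LinearOrderedCommGroupWithZero Γ]
    (v : Valuation F Γ) {d y : F} (hd : v d ≤ 1) (h : v (d - y ^ 2) < 1) : v y ≤ 1 := by
  have h1 : v (y ^ 2) ≤ 1 := by
    rw [← sub_sub_cancel d (y ^ 2)]
    exact v.map_sub_le hd h.le
  rw [map_pow] at h1
  exact (pow_le_one_iff two_ne_zero).1 h1

theorem valuation_sub_sq_lt_one {F Γ : Type*} [Field F] [LinearOrderedCommGroupWithZero Γ]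
    (v : Valuation F Γ) {d y r : F} (h : v (d - y ^ 2) < 1) (hy : v y ≤ 1) (hr : v r ≤ 1)
    (hry : v (r - y) < 1) : v (d - r ^ 2) < 1 := by
  rw [show d - r ^ 2 = (d - y ^ 2) - (r - y) * (r + y) by ring]
  refine v.map_sub_lt h ?_
  rw [map_mul]
  exact mul_lt_one_of_lt_of_le hry (v.map_add_le hr hy)

variable {K : Type*} [Field K] [NumberField K]

/-- Away from `2`, `b` and `d`, the symbol `(d / b² | 𝔭)` is decided by the integral element `d`
modulo `𝔭`. -/
theorem legendreSymbol_eq_one_or_neg_one {c : K} {b d : 𝓞 K}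
    (hcd : c * algebraMap (𝓞 K) K b ^ 2 = algebraMap (𝓞 K) K d)
    {p : HeightOneSpectrum (𝓞 K)} (h2 : (2 : 𝓞 K) ∉ p.asIdeal) (hb : b ∉ p.asIdeal)
    (hd : d ∉ p.asIdeal) :
    (legendreSymbol c p = 1 ∧ ∃ r : 𝓞 K, d - r ^ 2 ∈ p.asIdeal) ∨
      (legendreSymbol c p = -1 ∧ ∀ r : 𝓞 K, d - r ^ 2 ∉ p.asIdeal) := by
  have hvb : p.valuation K (algebraMap (𝓞 K) K b) = 1 :=
    p.valuation_eq_one_iff_notMem.2 hb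
  have hvc : p.valuation K c = 1 := by
    have h := congrArg (p.valuation K) hcd
    rwa [map_mul, map_pow, hvb, one_pow, mul_one, p.valuation_eq_one_iff_notMem.2 hd] at h
  have hiff : (∃ x : K, p.valuation K (c - x ^ 2) < 1) ↔ ∃ r : 𝓞 K, d - r ^ 2 ∈ p.asIdeal := by
    have hval : ∀ x : K, p.valuation K (c - x ^ 2) =
        p.valuation K (algebraMap (𝓞 K) K d - (x * algebraMap (𝓞 K) K b) ^ 2) := fun x => by
      rw [← hcd, mul_pow, ← sub_mul, map_mul, map_pow, hvb, one_pow, mul_one]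
    constructor
    · rintro ⟨x, hx⟩
      rw [hval] at hx
      set y := x * algebraMap (𝓞 K) K b
      have hy : p.valuation K y ≤ 1 := valuation_le_one_of_sub_sq _ (p.valuation_le_one d) hx
      obtain ⟨r, hr⟩ := p.exists_valuation_sub_lt_of_integer hy 1
      refine ⟨r, (p.valuation_lt_one_iff_mem (K := K) _).1 ?_⟩
      change p.valuation K (algebraMap (𝓞 K) K (d - r ^ 2)) < 1
      rw [map_sub, map_pow]
      exact valuation_sub_sq_lt_one _ hx hy (p.valuation_le_one r) (by simpa using hr)
    · rintro ⟨r, hr⟩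
      refine ⟨algebraMap (𝓞 K) K r / algebraMap (𝓞 K) K b, ?_⟩
      have hb0 : algebraMap (𝓞 K) K b ≠ 0 := fun h => by simp [h] at hvb
      rw [hval, div_mul_cancel₀ _ hb0, ← map_pow, ← map_sub]
      exact (p.valuation_lt_one_iff_mem (K := K) _).2 hr
  unfold legendreSymbol
  rw [if_neg (by simp [h2, hvc])]
  by_cases h : ∃ r : 𝓞 K, d - r ^ 2 ∈ p.asIdeal
  · exact Or.inl ⟨if_pos (hiff.2 h), h⟩
  · exact Or.inr ⟨if_neg (mt hiff.1 h), not_exists.1 h⟩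

theorem legendreSymbol_mem_Icc (c : K) (p : HeightOneSpectrum (𝓞 K)) :
    -1 ≤ legendreSymbol c p ∧ legendreSymbol c p ≤ 1 := by
  unfold legendreSymbol
  split_ifs <;> norm_num

variable {L : Type*} [Field L] [NumberField L] [Algebra K L] {d : 𝓞 K} {β : 𝓞 L}

/-- A root `r` of `x² = d` modulo `𝔭` produces a prime over `𝔭` containing `√d - r`; its conjugate
contains `-√d - r`, and no prime over `𝔭` contains both. -/
theorem exists_ne_under_eq (hβ : β ^ 2 = algebraMap (𝓞 K) (𝓞 L) d) (σ : 𝓞 L ≃ₐ[𝓞 K] 𝓞 L)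
    (hσ : σ β = -β) {p : HeightOneSpectrum (𝓞 K)} (h2 : (2 : 𝓞 K) ∉ p.asIdeal)
    (hd : d ∉ p.asIdeal) {r : 𝓞 K} (hr : d - r ^ 2 ∈ p.asIdeal) :
    ∃ P Q : HeightOneSpectrum (𝓞 L), P ≠ Q ∧ P.under (𝓞 K) = p ∧ Q.under (𝓞 K) = p := by
  have := p.isPrime
  obtain ⟨⟨I, hI, hIp⟩⟩ := (inferInstance : Nonempty (p.asIdeal.primesOver (𝓞 L)))
  let P : HeightOneSpectrum (𝓞 L) := ⟨I, hI, Ideal.ne_bot_of_liesOver_of_ne_bot p.ne_bot I⟩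
  have hmem : ∀ x : 𝓞 K, algebraMap (𝓞 K) (𝓞 L) x ∈ I ↔ x ∈ p.asIdeal := fun x => by
    rw [hIp.over]
    rfl
  have hP : P.under (𝓞 K) = p := HeightOneSpectrum.ext hIp.over.symm
  -- `(β - r) (β + r) = d - r²` lies in `I`, so after changing the sign of `r` the first factor does
  obtain ⟨r, hr, hrI⟩ : ∃ r : 𝓞 K, d - r ^ 2 ∈ p.asIdeal ∧ β - algebraMap (𝓞 K) (𝓞 L) r ∈ I := by
    have h : (β - algebraMap (𝓞 K) (𝓞 L) r) * (β - algebraMap (𝓞 K) (𝓞 L) (-r)) ∈ I := by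
      convert (hmem _).2 hr using 1
      rw [map_sub, map_pow, ← hβ, map_neg]
      ring
    rcases hI.mem_or_mem h with h | h
    · exact ⟨r, hr, h⟩
    · exact ⟨-r, by rwa [neg_sq], h⟩
  let Q : HeightOneSpectrum (𝓞 L) := P.comap (σ : 𝓞 L →+* 𝓞 L) σ.surjective
  refine ⟨P, Q, fun h => ?_, hP, ?_⟩
  · have hQ : β - algebraMap (𝓞 K) (𝓞 L) r ∈ Q.asIdeal := h ▸ hrI
    have hQ' : σ (β - algebraMap (𝓞 K) (𝓞 L) r) ∈ I := hQ
    rw [map_sub, hσ, AlgEquiv.commutes] at hQ'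
    have h3 : algebraMap (𝓞 K) (𝓞 L) (2 * r) ∈ I := by
      convert I.neg_mem (I.add_mem hrI hQ') using 1
      rw [map_mul, map_ofNat]
      ring
    have h4 := (p.isPrime.mem_or_mem ((hmem _).1 h3)).resolve_left h2
    exact hd ((Submodule.sub_mem_iff_left _ (p.asIdeal.pow_mem_of_mem h4 2 two_pos)).1 hr)
  · rw [← hP]
    refine HeightOneSpectrum.ext (Ideal.ext fun x => ?_)
    change σ (algebraMap (𝓞 K) (𝓞 L) x) ∈ I ↔ algebraMap (𝓞 K) (𝓞 L) x ∈ I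
    rw [AlgEquiv.commutes]

/-- If the residue field at `P` is no larger than the one below it, it already contains `√d`. -/
theorem exists_sub_sq_mem_under (hβ : β ^ 2 = algebraMap (𝓞 K) (𝓞 L) d)
    (P : HeightOneSpectrum (𝓞 L))
    (hP : Ideal.absNorm P.asIdeal = Ideal.absNorm (P.under (𝓞 K)).asIdeal) :
    ∃ r : 𝓞 K, d - r ^ 2 ∈ (P.under (𝓞 K)).asIdeal := by
  let f := Ideal.quotientMap (I := (P.under (𝓞 K)).asIdeal) P.asIdeal (algebraMap (𝓞 K) (𝓞 L))
    le_rfl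
  have hinj : Function.Injective f := Ideal.quotientMap_injective
  have hfin : Finite (𝓞 L ⧸ P.asIdeal) := (Ideal.absNorm_ne_zero_iff _).1 (by
    linarith [two_le_absNorm P])
  have hbij : Function.Bijective f := hinj.bijective_of_nat_card_le hP.le
  obtain ⟨x, hx⟩ := hbij.2 (Ideal.Quotient.mk _ β)
  obtain ⟨r, rfl⟩ := Ideal.Quotient.mk_surjective x
  refine ⟨r, ?_⟩
  have hx : Ideal.Quotient.mk P.asIdeal (algebraMap (𝓞 K) (𝓞 L) r) =
      Ideal.Quotient.mk P.asIdeal β := hx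
  change algebraMap (𝓞 K) (𝓞 L) (d - r ^ 2) ∈ P.asIdeal
  rw [← Ideal.Quotient.eq_zero_iff_mem, map_sub, ← hβ, map_pow, map_sub, map_pow, map_pow, hx,
    sub_self]

end Splitting

/-! ### Comparing sums over primes of a quadratic extension and of its base -/

section Comparison

variable {K : Type*} [Field K] [NumberField K] {L : Type*} [Field L] [NumberField L] [Algebra K L]

theorem absNorm_under_pow_inertiaDeg (P : HeightOneSpectrum (𝓞 L)) :
    Ideal.absNorm (P.under (𝓞 K)).asIdeal ^ P.asIdeal.inertiaDeg (𝓞 K) =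
      Ideal.absNorm P.asIdeal := by
  have := P.isPrime
  have : P.asIdeal.LiesOver (P.under (𝓞 K)).asIdeal := ⟨rfl⟩
  exact Ideal.absNorm_pow_inertiaDeg _ _

theorem inertiaDeg_base_pos (P : HeightOneSpectrum (𝓞 L)) : 0 < P.asIdeal.inertiaDeg (𝓞 K) := by
  have := P.isPrime
  exact Ideal.inertiaDeg_pos _ _

theorem absNorm_under_le (P : HeightOneSpectrum (𝓞 L)) :
    Ideal.absNorm (P.under (𝓞 K)).asIdeal ≤ Ideal.absNorm P.asIdeal := by
  rw [← absNorm_under_pow_inertiaDeg (K := K) P]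
  exact Nat.le_self_pow (inertiaDeg_base_pos P).ne' _

theorem finrank_ringOfIntegers (h : Module.finrank K L = 2) :
    Module.finrank (𝓞 K) (𝓞 L) = 2 := by
  rw [← h]
  exact (IsFractionRing.finrank_eq (𝓞 K) K (𝓞 L) L).symm

/-- The primes over `𝔭` of degree at least `e` contribute at most `2 / N𝔭ᵉ`. -/
theorem sum_inv_absNorm_over_le (h : Module.finrank K L = 2) (p : HeightOneSpectrum (𝓞 K))
    (F : Finset (HeightOneSpectrum (𝓞 L))) (hF : ∀ P ∈ F, P.under (𝓞 K) = p) (e : ℕ)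
    (he : ∀ P ∈ F, e ≤ P.asIdeal.inertiaDeg (𝓞 K)) :
    ∑ P ∈ F, (Ideal.absNorm P.asIdeal : ℝ)⁻¹ ≤ 2 * ((Ideal.absNorm p.asIdeal : ℝ) ^ e)⁻¹ := by
  have hp : (1 : ℝ) ≤ Ideal.absNorm p.asIdeal := by
    exact_mod_cast one_le_two.trans (two_le_absNorm p)
  calc _ ≤ ∑ P ∈ F, ((Ideal.absNorm p.asIdeal : ℝ) ^ e)⁻¹ := by
        refine Finset.sum_le_sum fun P hP => ?_
        rw [← absNorm_under_pow_inertiaDeg (K := K) P, hF P hP, Nat.cast_pow]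
        exact inv_anti₀ (by positivity) (pow_le_pow_right₀ hp (he P hP))
    _ = F.card * ((Ideal.absNorm p.asIdeal : ℝ) ^ e)⁻¹ := by rw [Finset.sum_const, nsmul_eq_mul]
    _ ≤ _ := by
        gcongr
        exact_mod_cast (card_le_finrank p F hF).trans (finrank_ringOfIntegers h).le

open scoped Classical in
/-- A crude bound at a single prime, for the finitely many exceptional ones. -/
theorem abs_sum_over_sub_le (h : Module.finrank K L = 2) (c : K) (p : HeightOneSpectrum (𝓞 K))
    (X : ℝ) :
    |∑ P ∈ primesUpTo L X with P.under (𝓞 K) = p, (Ideal.absNorm P.asIdeal : ℝ)⁻¹ -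
      (1 + (legendreSymbol c p : ℝ)) / Ideal.absNorm p.asIdeal| ≤ 2 := by
  have hp : (1 : ℝ) ≤ Ideal.absNorm p.asIdeal := by
    exact_mod_cast one_le_two.trans (two_le_absNorm p)
  have hinv : (Ideal.absNorm p.asIdeal : ℝ)⁻¹ ≤ 1 := inv_le_one_of_one_le₀ hp
  have hinv0 : 0 ≤ (Ideal.absNorm p.asIdeal : ℝ)⁻¹ := by positivity
  have h1 := sum_inv_absNorm_over_le h p {P ∈ primesUpTo L X | P.under (𝓞 K) = p}
    (fun P hP => (Finset.mem_filter.1 hP).2) 1 fun P _ => inertiaDeg_base_pos P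
  have h0 : 0 ≤ ∑ P ∈ primesUpTo L X with P.under (𝓞 K) = p, (Ideal.absNorm P.asIdeal : ℝ)⁻¹ :=
    Finset.sum_nonneg fun _ _ => by positivity
  obtain ⟨hl, hu⟩ := legendreSymbol_mem_Icc c p
  have hl : (-1 : ℝ) ≤ legendreSymbol c p := by exact_mod_cast hl
  have hu : (legendreSymbol c p : ℝ) ≤ 1 := by exact_mod_cast hu
  rw [pow_one] at h1
  rw [div_eq_mul_inv, abs_le]
  constructor <;> nlinarith

open scoped Classical in
/-- Away from finitely many primes, the primes of degree one over `𝔭` number `1 + (c / 𝔭)`, and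
those of degree two contribute only `O(1 / N𝔭²)`. -/
theorem abs_sum_over_sub_le_inv_sq (h : Module.finrank K L = 2) {c : K} {b d : 𝓞 K} {β : 𝓞 L}
    (hcd : c * algebraMap (𝓞 K) K b ^ 2 = algebraMap (𝓞 K) K d)
    (hβ : β ^ 2 = algebraMap (𝓞 K) (𝓞 L) d) (σ : 𝓞 L ≃ₐ[𝓞 K] 𝓞 L) (hσ : σ β = -β)
    {p : HeightOneSpectrum (𝓞 K)} (hp : 2 * b * d ∉ p.asIdeal) {X : ℝ}
    (hX : (Ideal.absNorm p.asIdeal : ℝ) ≤ X) :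
    |∑ P ∈ primesUpTo L X with P.under (𝓞 K) = p, (Ideal.absNorm P.asIdeal : ℝ)⁻¹ -
      (1 + (legendreSymbol c p : ℝ)) / Ideal.absNorm p.asIdeal| ≤
      2 * ((Ideal.absNorm p.asIdeal : ℝ) ^ 2)⁻¹ := by
  have hd : d ∉ p.asIdeal := fun h => hp (p.asIdeal.mul_mem_left _ h)
  have h2b : 2 * b ∉ p.asIdeal := fun h => hp (p.asIdeal.mul_mem_right _ h)
  have hb : b ∉ p.asIdeal := fun h => h2b (p.asIdeal.mul_mem_left _ h)
  have h2 : (2 : 𝓞 K) ∉ p.asIdeal := fun h => h2b (p.asIdeal.mul_mem_right _ h)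
  set F := (primesUpTo L X).filter fun P => P.under (𝓞 K) = p with hF
  have hFp : ∀ P ∈ F, P.under (𝓞 K) = p := fun P hP => (Finset.mem_filter.1 hP).2
  rcases legendreSymbol_eq_one_or_neg_one hcd h2 hb hd with ⟨hc, r, hr⟩ | ⟨hc, hr⟩
  · obtain ⟨P, Q, hPQ, hP, hQ⟩ := exists_ne_under_eq hβ σ hσ h2 hd hr
    have hover : ∀ R ∈ ({P, Q} : Finset (HeightOneSpectrum (𝓞 L))), R.under (𝓞 K) = p := by
      simp [hP, hQ]
    -- two primes of total degree at most `2` have degree one each, and no third prime fits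
    have hdeg := (sum_inertiaDeg_le_finrank p _ hover).trans (finrank_ringOfIntegers h).le
    rw [Finset.sum_pair hPQ] at hdeg
    have hP1 := inertiaDeg_base_pos (K := K) P
    have hQ1 := inertiaDeg_base_pos (K := K) Q
    have hNP := absNorm_under_pow_inertiaDeg (K := K) P
    have hNQ := absNorm_under_pow_inertiaDeg (K := K) Q
    rw [show P.asIdeal.inertiaDeg (𝓞 K) = 1 by omega, pow_one, hP] at hNP
    rw [show Q.asIdeal.inertiaDeg (𝓞 K) = 1 by omega, pow_one, hQ] at hNQ
    have hsub : {P, Q} ⊆ F := by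
      intro R hR
      refine Finset.mem_filter.2 ⟨(mem_primesUpTo L).2 ?_, hover R hR⟩
      rcases Finset.mem_insert.1 hR with rfl | hR
      · rwa [← hNP]
      · rwa [Finset.mem_singleton.1 hR, ← hNQ]
    have hFeq : {P, Q} = F := Finset.eq_of_subset_of_card_le hsub (by
      rw [Finset.card_pair hPQ]
      exact (card_le_finrank p F hFp).trans (finrank_ringOfIntegers h).le)
    rw [← hFeq, Finset.sum_pair hPQ, ← hNP, ← hNQ, hc]
    have : (Ideal.absNorm p.asIdeal : ℝ)⁻¹ + (Ideal.absNorm p.asIdeal : ℝ)⁻¹ -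
        (1 + ((1 : ℤ) : ℝ)) / Ideal.absNorm p.asIdeal = 0 := by
      push_cast
      ring
    rw [this, abs_zero]
    positivity
  · have hdeg : ∀ P ∈ F, 2 ≤ P.asIdeal.inertiaDeg (𝓞 K) := fun P hP => by
      by_contra hlt
      have hP1 := inertiaDeg_base_pos (K := K) P
      have hN := absNorm_under_pow_inertiaDeg (K := K) P
      rw [show P.asIdeal.inertiaDeg (𝓞 K) = 1 by omega, pow_one] at hN
      obtain ⟨r, h⟩ := exists_sub_sq_mem_under hβ P hN.symm
      exact hr r (hFp P hP ▸ h)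
    rw [hc, show (1 + ((-1 : ℤ) : ℝ)) / Ideal.absNorm p.asIdeal = 0 by norm_num, sub_zero,
      abs_of_nonneg (Finset.sum_nonneg fun _ _ => by positivity)]
    exact sum_inv_absNorm_over_le h p F hFp 2 hdeg

/-- Grouping the primes of `L` by the prime of `K` below them. -/
theorem exists_abs_sum_sub_sum_le (h : Module.finrank K L = 2) {c : K} {b d : 𝓞 K} {β : 𝓞 L}
    (hb : b ≠ 0) (hd : d ≠ 0) (hcd : c * algebraMap (𝓞 K) K b ^ 2 = algebraMap (𝓞 K) K d)
    (hβ : β ^ 2 = algebraMap (𝓞 K) (𝓞 L) d) (σ : 𝓞 L ≃ₐ[𝓞 K] 𝓞 L) (hσ : σ β = -β) :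
    ∃ C : ℝ, ∀ X : ℝ, |∑ P ∈ primesUpTo L X, (Ideal.absNorm P.asIdeal : ℝ)⁻¹ -
      ∑ p ∈ primesUpTo K X, (1 + (legendreSymbol c p : ℝ)) / Ideal.absNorm p.asIdeal| ≤ C := by
  classical
  -- the primes where the symbol, the denominator of `c`, or ramification may interfere
  have hbad : {p : HeightOneSpectrum (𝓞 K) | 2 * b * d ∈ p.asIdeal}.Finite := by
    refine (Ideal.finite_factors (I := Ideal.span {2 * b * d}) ?_).subset fun p hp => ?_
    · simp [hb, hd]
    · exact Ideal.dvd_span_singleton.2 hp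
  refine ⟨2 * ∑' p : HeightOneSpectrum (𝓞 K), ((Ideal.absNorm p.asIdeal : ℝ) ^ 2)⁻¹ +
    2 * hbad.toFinset.card, fun X => ?_⟩
  have hmaps : ∀ P ∈ primesUpTo L X, P.under (𝓞 K) ∈ primesUpTo K X := fun P hP => by
    rw [mem_primesUpTo] at hP ⊢
    refine le_trans ?_ hP
    exact_mod_cast absNorm_under_le P
  rw [← Finset.sum_fiberwise_of_maps_to hmaps, ← Finset.sum_sub_distrib]
  calc _ ≤ ∑ p ∈ primesUpTo K X, (2 * ((Ideal.absNorm p.asIdeal : ℝ) ^ 2)⁻¹ +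
          if p ∈ hbad.toFinset then 2 else 0) := by
        refine (Finset.abs_sum_le_sum_abs _ _).trans (Finset.sum_le_sum fun p hp => ?_)
        split_ifs with hpb
        · have : 0 ≤ 2 * ((Ideal.absNorm p.asIdeal : ℝ) ^ 2)⁻¹ := by positivity
          linarith [abs_sum_over_sub_le h c p X]
        · rw [add_zero]
          exact abs_sum_over_sub_le_inv_sq h hcd hβ σ hσ (by simpa using hpb)
            ((mem_primesUpTo K).1 hp)
    _ ≤ _ := by
        rw [Finset.sum_add_distrib, ← Finset.mul_sum]
        gcongr
        · exact (summable_absNorm_inv_sq K).sum_le_tsum _ fun _ _ => by positivity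
        · rw [← Finset.sum_filter, Finset.sum_const, nsmul_eq_mul, mul_comm]
          gcongr
          exact fun p hp => (Finset.mem_filter.1 hp).2

end Comparison

/-! ### The field `K(√c)` -/

section Quadratic

open Polynomial in
/-- The field `K(√c)`, with the integral element `b √c` for a denominator `b` of `c`. -/
theorem exists_quadratic_extension.{u} {K : Type u} [Field K] [NumberField K] (c : Kˣ)
    (hc : ¬ IsSquare c) :
    ∃ (L : Type u) (_ : Field L) (_ : NumberField L) (_ : Algebra K L) (b d : 𝓞 K) (β : 𝓞 L)
      (σ : 𝓞 L ≃ₐ[𝓞 K] 𝓞 L), Module.finrank K L = 2 ∧ b ≠ 0 ∧ d ≠ 0 ∧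
      (c : K) * algebraMap (𝓞 K) K b ^ 2 = algebraMap (𝓞 K) K d ∧
      β ^ 2 = algebraMap (𝓞 K) (𝓞 L) d ∧ σ β = -β := by
  have hirr : Irreducible (X ^ 2 - C (c : K)) := by
    refine X_pow_sub_C_irreducible_of_prime Nat.prime_two fun x hx => hc ?_
    have hx0 : x ≠ 0 := fun h => c.ne_zero (by rw [← hx, h, zero_pow two_ne_zero])
    exact ⟨Units.mk0 x hx0, Units.ext (by rw [← hx]; simp [sq])⟩
  have := Fact.mk hirr
  let L := AdjoinRoot (X ^ 2 - C (c : K))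
  let α : L := AdjoinRoot.root _
  have hα : α ^ 2 = algebraMap K L c := by
    have h := AdjoinRoot.eval₂_root (X ^ 2 - C (c : K))
    rw [eval₂_sub, eval₂_pow, eval₂_X, eval₂_C, sub_eq_zero] at h
    exact h
  have hfin : Module.Finite K L := (AdjoinRoot.powerBasis hirr.ne_zero).finite
  have hdeg : Module.finrank K L = 2 := by
    rw [(AdjoinRoot.powerBasis hirr.ne_zero).finrank, AdjoinRoot.powerBasis_dim,
      natDegree_X_pow_sub_C]
  have hchar : CharZero L := charZero_of_injective_algebraMap (algebraMap K L).injective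
  have hL : NumberField L := NumberField.of_module_finite K L
  let τ : L →ₐ[K] L := AdjoinRoot.liftAlgHom _ (Algebra.ofId K L) (-α) (by
    rw [eval₂_sub, eval₂_pow, eval₂_X, eval₂_C, neg_sq, hα]
    exact sub_self _)
  have hτ : τ α = -α := AdjoinRoot.liftAlgHom_root ..
  let σ : L ≃ₐ[K] L := AlgEquiv.ofBijective τ (Algebra.IsAlgebraic.algHom_bijective τ)
  obtain ⟨a, b, hb, hab⟩ := IsFractionRing.div_surjective (A := 𝓞 K) (c : K)
  have hb0 : b ≠ 0 := nonZeroDivisors.ne_zero hb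
  have hbK : algebraMap (𝓞 K) K b ≠ 0 := by simpa using hb0
  have hcd : (c : K) * algebraMap (𝓞 K) K b ^ 2 = algebraMap (𝓞 K) K (a * b) := by
    rw [← hab, map_mul]
    field_simp
  have hd0 : a * b ≠ 0 := fun h => by
    rw [h, map_zero] at hcd
    exact mul_ne_zero c.ne_zero (pow_ne_zero 2 hbK) hcd
  have hsq : (α * algebraMap K L (algebraMap (𝓞 K) K b)) ^ 2 =
      algebraMap (𝓞 L) L (algebraMap (𝓞 K) (𝓞 L) (a * b)) := by
    rw [mul_pow, hα, ← map_pow, ← map_mul, hcd]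
    rfl
  have hint : IsIntegral ℤ (α * algebraMap K L (algebraMap (𝓞 K) K b)) := by
    refine IsIntegral.of_pow two_pos ?_
    rw [hsq]
    exact RingOfIntegers.isIntegral_coe _
  refine ⟨L, inferInstance, hL, inferInstance, b, a * b, ⟨_, hint⟩,
    galRestrict (𝓞 K) K L (𝓞 L) σ, hdeg, hb0, hd0, hcd, ?_, ?_⟩
  · exact RingOfIntegers.ext hsq
  · refine RingOfIntegers.ext ?_
    refine (algebraMap_galRestrict_apply (𝓞 K) (K := K) (L := L) (B := 𝓞 L) σ _).trans ?_
    change τ (α * algebraMap K L (algebraMap (𝓞 K) K b)) =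
      -(α * algebraMap K L (algebraMap (𝓞 K) K b))
    rw [map_mul, hτ, AlgHom.commutes, neg_mul]

end Quadratic

end NumberFieldLegendre

theorem mainTheorem7 (K : Type*) [Field K] [NumberField K] (c : Kˣ) (hc : ¬ IsSquare c) :
    (fun X : ℝ =>
        (∑ 𝔭 ∈ NumberFieldLegendre.primesUpTo K X,
          (1 + (NumberFieldLegendre.legendreSymbol (c : K) 𝔭 : ℝ)) /
            (Ideal.absNorm 𝔭.asIdeal : ℝ))
          - Real.log (Real.log X))
      =O[atTop] (fun _ : ℝ => (1 : ℝ)) := by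
  obtain ⟨L, _, _, _, b, d, β, σ, hdeg, hb, hd, hcd, hβ, hσ⟩ :=
    NumberFieldLegendre.exists_quadratic_extension c hc
  obtain ⟨C, hC⟩ := NumberFieldLegendre.exists_abs_sum_sub_sum_le hdeg hb hd hcd hβ σ hσ
  have hdiff : (fun X : ℝ => ∑ P ∈ NumberFieldLegendre.primesUpTo L X,
      (Ideal.absNorm P.asIdeal : ℝ)⁻¹ - ∑ p ∈ NumberFieldLegendre.primesUpTo K X,
        (1 + (NumberFieldLegendre.legendreSymbol (c : K) p : ℝ)) / Ideal.absNorm p.asIdeal)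
      =O[atTop] (fun _ : ℝ => (1 : ℝ)) :=
    IsBigO.of_bound C (Eventually.of_forall fun X => by simpa using hC X)
  refine ((NumberFieldLegendre.sum_primesUpTo_inv_absNorm_isBigO L).sub hdiff).congr_left
    fun X => ?_
  ring
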